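/- Let $M$ be a rational homology 3-sphere (a connected closed 3-manifold with $H_*(M;\mathbb{Q})\cong H_*(S^3;\mathbb{Q})$) and let $\mathcal{K}$ be a link in $M$ with countably infinitely many tame components, pairwise disjoint, which is admissible, that is, its components generate $H_1(M)=H_1(M;\mathbb{Z})$. For a component $K$ let $V_K$ be a tubular neighbourhood of $K$, and let $v_K:H_1(\partial V_K)\to H_1(V_K)\cong\mathbb{Z}$ be induced by inclusion. (The group $H_1(\partial V_K)$ does not depend on the size of $V_K$, and for every finite sublink $L$ of $\mathcal{K}$, shrinking $V_K$ until it misses the components of $L$ other than $K$ gives a well-defined map $H_1(\partial V_K)\to H_1(M-L)$.) The idele group is $$\mathcal{J}_{M,\mathcal{K}}=\Bigl\{(\alpha_K)_K\in\prod_{K\subset\mathcal{K}}H_1(\partial V_K)\ \Big|\ v_K(\alpha_K)=0\text{ for all but finitely many }K\Bigr\}.$$ Write $H_1(M-\mathcal{K})=\varprojlim_L H_1(M-L)$ and $H_2(M,\mathcal{K})=\varinjlim_L H_2(M,L)$, where $L$ runs over the finite sublinks of $\mathcal{K}$. Let $\tilde\rho:\mathcal{J}_{M,\mathcal{K}}\to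 H_1(M-\mathcal{K})$ be the homomorphism whose component in $H_1(M-L)$ sends $(\alpha_K)_K$ to the sum of the images of the $\alpha_K$ (only finitely many of which are non-zero). Let $\Delta:H_2(M,\mathcal{K})\to\mathcal{J}_{M,\mathcal{K}}$ be the homomorphism whose components at the knots of a finite sublink $L$ are given on $H_2(M,L)$ by $$H_2(M,L)\cong H_2(M,V)\cong H_2(M-\mathrm{Int}\,V,\partial V)\xrightarrow{\ \partial\ }H_1(\partial V)=\bigoplus_{K\subset L}H_1(\partial V_K),\qquad V=\bigsqcup_{K\subset L}V_K,$$ with the $V_K$ $(K\subset L)$ pairwise disjoint. The group of principal ideles is $\mathcal{P}_{M,\mathcal{K}}=\mathrm{Im}\,\Delta$. Let $h:N\to M$ be a finite abelian cover branched along a finite sublink $L$ of $\mathcal{K}$, with group of deck transformations $\mathrm{Gal}(h)$. The global norm residue symbol $(\alpha,h)\in\mathrm{Gal}(h)$ of $\alpha\in\mathcal{J}_{M,\mathcal{K}}$ is the image of $\alpha$ under $$\mathcal{J}_{M,\mathcal{K}}\xrightarrow{\tilde\rho}H_1(M-\mathcal{K})\to H_1(M-L)\to\mathrm{Gal}(h),$$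 where the last map sends the class of a loop to the deck transformation $g$ such that the lifts of the loop run from $y$ to $g(y)$. For a component $K$ of $\mathcal{K}$, take $V_K$ so small that it misses the components of $L$ other than $K$, let $h_K$ be the restriction of $h$ to a connected component of $h^{-1}(\partial V_K)$, as a cover of $\partial V_K$, and let $(\ ,h_K):H_1(\partial V_K)\to\mathrm{Gal}(h_K)$ be defined by lifting loops in the same way. There is a natural map $\mathrm{Gal}(h_K)\to\mathrm{Gal}(h)$, which sends a deck transformation of the component to its unique extension, and the image of $(\alpha_K,h_K)$ under it is again denoted by $(\alpha_K,h_K)$. Then, for every $\alpha=(\alpha_K)_K\in\mathcal{J}_{M,\mathcal{K}}$, and for any choice of the $V_K$ and of the components of the $h^{-1}(\partial V_K)$ as above, $(\alpha_K,h_K)=\mathrm{id}$ for all but finitely many $K$, and $$(\alpha,h)=\prod_{K\subset\mathcal{K}}(\alpha_K,h_K)\quad\text{in }\mathrm{Gal}(h).$$ If in addition $\alpha\in\mathcal{P}_{M,\mathcal{K}}$, then $(\alpha,h)=\mathrm{id}$. -/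

import Mathlib

noncomputable section

open CategoryTheory CategoryTheory.Limits Simplicial Topology

namespace KnotIdele

/-! ### Singular homology -/

/-- The singular chain complex of a space, with integral coefficients. -/
abbrev chains (X : Type) [TopologicalSpace X] : ChainComplex (ModuleCat.{0} ℤ) ℕ :=
  ((AlgebraicTopology.singularChainComplexFunctor (ModuleCat.{0} ℤ)).obj
    (ModuleCat.of ℤ ℤ)).obj (TopCat.of X)

/-- The chain map induced by a continuous map. -/
abbrev chainsMap {X Y : Type} [TopologicalSpace X] [TopologicalSpace Y] (f : C(X, Y)) :
    chains X ⟶ chains Y :=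
  ((AlgebraicTopology.singularChainComplexFunctor (ModuleCat.{0} ℤ)).obj
    (ModuleCat.of ℤ ℤ)).map (TopCat.ofHom f)

/-- The first integral singular homology group. -/
abbrev H₁ (X : Type) [TopologicalSpace X] : Type := (chains X).homology 1

/-- The homomorphism on first homology induced by a continuous map. -/
def H₁.map {X Y : Type} [TopologicalSpace X] [TopologicalSpace Y] (f : C(X, Y)) :
    H₁ X →ₗ[ℤ] H₁ Y :=
  (HomologicalComplex.homologyMap (chainsMap f) 1).hom

theorem H₁.map_comp {X Y Z : Type} [TopologicalSpace X] [TopologicalSpace Y] [TopologicalSpace Z]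
    (g : C(Y, Z)) (f : C(X, Y)) (a : H₁ X) : H₁.map (g.comp f) a = H₁.map g (H₁.map f a) := by
  simp only [H₁.map, chainsMap, TopCat.ofHom_comp, Functor.map_comp,
    HomologicalComplex.homologyMap_comp, ModuleCat.hom_comp, LinearMap.comp_apply]

theorem H₁.map_congr_of_homotopic {X Y : Type} [TopologicalSpace X] [TopologicalSpace Y]
    {f g : C(X, Y)} (H : f.Homotopic g) : H₁.map f = H₁.map g := by
  obtain ⟨H⟩ := H
  have := TopCat.Homotopy.congr_homologyMap_singularChainComplexFunctor
    (C := ModuleCat.{0} ℤ) (X := TopCat.of X) (Y := TopCat.of Y) (f := TopCat.ofHom f)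
    (g := TopCat.ofHom g) H (ModuleCat.of ℤ ℤ) 1
  simp only [H₁.map, chainsMap, this]

/-- A space with the rational homology of the 3-sphere. -/
def HasRationalHomologyOfThreeSphere (M : Type) [TopologicalSpace M] : Prop :=
  ∀ n : ℕ, Nonempty
    ((((AlgebraicTopology.singularHomologyFunctor (ModuleCat.{0} ℚ) n).obj
        (ModuleCat.of ℚ ℚ)).obj (TopCat.of M)) ≅
      (((AlgebraicTopology.singularHomologyFunctor (ModuleCat.{0} ℚ) n).obj
        (ModuleCat.of ℚ ℚ)).obj (TopCat.of (Metric.sphere (0 : EuclideanSpace ℝ (Fin 4)) 1))))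

section Pairs

variable {M : Type} [TopologicalSpace M]

/-- The inclusion of a subspace in a larger subspace. -/
def incl {A B : Set M} (h : A ⊆ B) : C(A, B) := ⟨Set.inclusion h, continuous_inclusion h⟩

/-- The singular chain complex `C(B) / C(A)` of the pair `(B, A)` of subspaces `A ⊆ B`. -/
abbrev relChains {A B : Set M} (h : A ⊆ B) : ChainComplex (ModuleCat.{0} ℤ) ℕ :=
  cokernel (chainsMap (incl h))

/-- The sequence `0 → C(A) → C(B) → C(B) / C(A) → 0`. -/
def pairSequence {A B : Set M} (h : A ⊆ B) :
    ShortComplex (ChainComplex (ModuleCat.{0} ℤ) ℕ) :=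
  ShortComplex.mk (chainsMap (incl h)) (cokernel.π (chainsMap (incl h))) (cokernel.condition _)

theorem pairSequence_shortExact {A B : Set M} (h : A ⊆ B) : (pairSequence h).ShortExact where
  exact := ShortComplex.exact_cokernel _
  mono_f := by
    have : Mono (TopCat.ofHom (incl h)) :=
      (TopCat.mono_iff_injective _).2 (Set.inclusion_injective h)
    exact inferInstanceAs (Mono (chainsMap (incl h)))
  epi_g := coequalizer.π_epi

/-- The second relative homology group `H₂(B, A)`. -/
abbrev relH₂ {A B : Set M} (h : A ⊆ B) : Type := (relChains h).homology 2

/-- The boundary homomorphism `H₂(B, A) → H₁(A)` of the long exact sequence of a pair. -/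
def relBoundary {A B : Set M} (h : A ⊆ B) : relH₂ h →ₗ[ℤ] H₁ A :=
  ((pairSequence_shortExact h).δ 2 1 rfl).hom

/-- The chain map `C(B) / C(A) → C(B') / C(A')` induced by inclusions `A ⊆ A'` and `B ⊆ B'`. -/
def relChainsMap {A B A' B' : Set M} (h : A ⊆ B) (h' : A' ⊆ B') (hA : A ⊆ A') (hB : B ⊆ B') :
    relChains h ⟶ relChains h' :=
  cokernel.map (chainsMap (incl h)) (chainsMap (incl h')) (chainsMap (incl hA))
    (chainsMap (incl hB)) (by simp only [chainsMap, ← Functor.map_comp]; rfl)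

theorem relChainsMap_comp {A B A' B' A'' B'' : Set M} (h : A ⊆ B) (h' : A' ⊆ B') (h'' : A'' ⊆ B'')
    (hA : A ⊆ A') (hB : B ⊆ B') (hA' : A' ⊆ A'') (hB' : B' ⊆ B'') :
    relChainsMap h h' hA hB ≫ relChainsMap h' h'' hA' hB' =
      relChainsMap h h'' (hA.trans hA') (hB.trans hB') := by
  refine (cancel_epi (cokernel.π (chainsMap (incl h)))).1 ?_
  simp only [relChainsMap, cokernel.map, cokernel.π_desc, cokernel.π_desc_assoc, Category.assoc]
  rw [← Category.assoc]
  congr 1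
  simp only [chainsMap, ← Functor.map_comp]; rfl

/-- The homomorphism `H₂(B, A) → H₂(B', A')` induced by inclusions `A ⊆ A'` and `B ⊆ B'`. -/
def relMap {A B A' B' : Set M} (h : A ⊆ B) (h' : A' ⊆ B') (hA : A ⊆ A') (hB : B ⊆ B') :
    relH₂ h →ₗ[ℤ] relH₂ h' :=
  (HomologicalComplex.homologyMap (relChainsMap h h' hA hB) 2).hom

theorem relMap_relMap {A B A' B' A'' B'' : Set M} (h : A ⊆ B) (h' : A' ⊆ B') (h'' : A'' ⊆ B'')
    (hA : A ⊆ A') (hB : B ⊆ B') (hA' : A' ⊆ A'') (hB' : B' ⊆ B'') (a : relH₂ h) :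
    relMap h' h'' hA' hB' (relMap h h' hA hB a) =
      relMap h h'' (hA.trans hA') (hB.trans hB') a := by
  simp only [relMap, ← relChainsMap_comp h h' h'' hA hB hA' hB',
    HomologicalComplex.homologyMap_comp, ModuleCat.hom_comp, LinearMap.comp_apply]

end Pairs
section Reciprocity

/-! ### The reciprocity homomorphism of a regular covering with abelian group -/

variable {Y X : Type} [TopologicalSpace Y] [TopologicalSpace X] {p : Y → X}
  {G : Type} [CommGroup G] [MulAction G Y] (hp : IsQuotientCoveringMap p G)

/-- A point of the fibre over `x`. -/
def fibrePoint (x : X) : Y := (hp.surjective x).choose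

theorem fibrePoint_spec (x : X) : p (fibrePoint hp x) = x := (hp.surjective x).choose_spec

/-- The element of the group that moves the chosen point of its fibre to `y`. -/
def fibreCoord (y : Y) : G :=
  (hp.apply_eq_iff_mem_orbit.1 (fibrePoint_spec hp (p y)).symm).choose

theorem fibreCoord_spec (y : Y) : fibreCoord hp y • fibrePoint hp (p y) = y :=
  (hp.apply_eq_iff_mem_orbit.1 (fibrePoint_spec hp (p y)).symm).choose_spec

theorem fibreCoord_eq {g : G} {y : Y} {x : X} (hy : g • fibrePoint hp x = y) :
    fibreCoord hp y = g := by
  have hx : p y = x := by rw [← hy, hp.map_smul]; exact fibrePoint_spec hp x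
  have := hp.isCancelSMul
  subst hx
  exact IsCancelSMul.right_cancel _ _ _ ((fibreCoord_spec hp y).trans hy.symm)

theorem fibreCoord_smul (g : G) (y : Y) : fibreCoord hp (g • y) = g * fibreCoord hp y :=
  fibreCoord_eq hp (x := p y) (by rw [mul_smul, fibreCoord_spec])

theorem exists_lift_simplex (hp : IsQuotientCoveringMap p G) {n : ℕ} (σ : C(stdSimplex ℝ (Fin (n + 1)), X)) :
    ∃ Γ : C(stdSimplex ℝ (Fin (n + 1)), Y), p ∘ Γ = σ := by
  have := (convex_stdSimplex ℝ (Fin (n + 1))).contractibleSpace ⟨_, single_mem_stdSimplex ℝ 0⟩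
  have := (convex_stdSimplex ℝ (Fin (n + 1))).locallyPathConnectedSpace
  obtain ⟨Γ, h, -⟩ := hp.isCoveringMap.existsUnique_continuousMap_lifts σ (stdSimplex.vertex 0)
    (fibrePoint hp (σ (stdSimplex.vertex 0))) (fibrePoint_spec hp _)
  exact ⟨Γ, h.2⟩

/-- A lift of a singular simplex. -/
def liftSimplex {n : ℕ} (σ : C(stdSimplex ℝ (Fin (n + 1)), X)) :
    C(stdSimplex ℝ (Fin (n + 1)), Y) := (exists_lift_simplex hp σ).choose

theorem liftSimplex_spec {n : ℕ} (σ : C(stdSimplex ℝ (Fin (n + 1)), X)) :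
    p ∘ liftSimplex hp σ = σ := (exists_lift_simplex hp σ).choose_spec

/-- The monodromy of a singular `1`-simplex `σ`, measured in the chosen points `s` of the fibres:
if a lift of `σ` runs from `a • s (σ 0)` to `b • s (σ 1)`, then it is `a⁻¹ * b`. For a loop `σ`
this is the element `g` such that a lift of `σ` runs from a point `y` to `g • y`. -/
def monodromyElement (σ : C(stdSimplex ℝ (Fin 2), X)) : G :=
  (fibreCoord hp (liftSimplex hp σ (stdSimplex.vertex 0)))⁻¹ *
    fibreCoord hp (liftSimplex hp σ (stdSimplex.vertex 1))

theorem monodromyElement_eq (σ : C(stdSimplex ℝ (Fin 2), X)) (Γ : C(stdSimplex ℝ (Fin 2), Y))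
    (h : p ∘ Γ = σ) : monodromyElement hp σ =
      (fibreCoord hp (Γ (stdSimplex.vertex 0)))⁻¹ * fibreCoord hp (Γ (stdSimplex.vertex 1)) := by
  have h0 : p (Γ (stdSimplex.vertex 0)) = p (liftSimplex hp σ (stdSimplex.vertex 0)) :=
    (congrFun h _).trans (congrFun (liftSimplex_spec hp σ) _).symm
  obtain ⟨g, hg⟩ := hp.apply_eq_iff_mem_orbit.1 h0
  have := (convex_stdSimplex ℝ (Fin 2)).contractibleSpace ⟨_, single_mem_stdSimplex ℝ 0⟩
  have := hp.toContinuousConstSMul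
  have key : (Γ : stdSimplex ℝ (Fin 2) → Y) = fun t => g • liftSimplex hp σ t := by
    refine hp.isCoveringMap.eq_of_comp_eq Γ.continuous
      ((continuous_const_smul g).comp (liftSimplex hp σ).continuous) ?_ (stdSimplex.vertex 0)
      hg.symm
    rw [h, ← liftSimplex_spec hp σ]
    funext t
    exact (hp.map_smul g).symm
  rw [key]
  simp only [fibreCoord_smul, monodromyElement]
  group

/-- The homomorphism on singular `1`-chains given by the monodromy of `1`-simplices. -/
def monodromyCochain :
    ((TopCat.toSSet.obj (TopCat.of X)).chainComplex (ModuleCat.of ℤ ℤ)).X 1 ⟶ ModuleCat.of ℤ (Additive G) :=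
  Sigma.desc fun σ : (TopCat.toSSet.obj (TopCat.of X)) _⦋1⦌ =>
    ModuleCat.ofHom (LinearMap.toSpanSingleton ℤ (Additive G)
      (Additive.ofMul (monodromyElement hp ((TopCat.toSSetObjEquiv _ _) σ))))

theorem ι_monodromyCochain (σ : (TopCat.toSSet.obj (TopCat.of X)) _⦋1⦌) :
    (TopCat.toSSet.obj (TopCat.of X)).ιChainComplex σ ≫ monodromyCochain hp =
      ModuleCat.ofHom (LinearMap.toSpanSingleton ℤ (Additive G)
      (Additive.ofMul (monodromyElement hp ((TopCat.toSSetObjEquiv _ _) σ)))) :=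
  Sigma.ι_desc _ _

theorem monodromyCochain_cocycle :
    ((TopCat.toSSet.obj (TopCat.of X)).chainComplex (ModuleCat.of ℤ ℤ)).d 2 1 ≫
      monodromyCochain hp = 0 := by
  refine SSet.chainComplex_hom_ext fun τ => ?_
  rw [comp_zero, SSet.ιChainComplex_d_assoc, Fin.sum_univ_three]
  simp only [Preadditive.add_comp, Preadditive.zsmul_comp, ι_monodromyCochain]
  set T : C(stdSimplex ℝ (Fin 3), X) := TopCat.toSSetObjEquiv _ _ τ with hT
  have hface (i : Fin 3) : TopCat.toSSetObjEquiv _ _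
      ((TopCat.toSSet.obj (TopCat.of X)).δ i τ) =
        T.comp ⟨stdSimplex.map (i.succAbove), stdSimplex.continuous_map _⟩ := rfl
  have hmon (i : Fin 3) := monodromyElement_eq hp _
    ((liftSimplex hp T).comp ⟨stdSimplex.map (i.succAbove), stdSimplex.continuous_map _⟩)
    (show p ∘ _ = ⇑(T.comp ⟨stdSimplex.map (i.succAbove), stdSimplex.continuous_map _⟩) by
      rw [ContinuousMap.coe_comp, ContinuousMap.coe_comp, ← Function.comp_assoc,
        liftSimplex_spec])
  simp only [ContinuousMap.comp_apply, ContinuousMap.coe_mk, stdSimplex.map_vertex] at hmon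
  simp only [hface, hmon]
  ext
  simp [LinearMap.toSpanSingleton_apply, Fin.succAbove]

/-- The reciprocity homomorphism `H₁(X) → G` of a covering `Y → X` with abelian group `G`. -/
def reciprocity : H₁ X →+ Additive G :=
  ((chains X).homologyι 1 ≫
    (chains X).descOpcycles (monodromyCochain hp) 2 (by simp) (monodromyCochain_cocycle hp)).hom

end Reciprocity

/-! ### Links with tubular neighbourhoods -/

/-- The torus `S¹ × S¹`, the model of the boundary of a tubular neighbourhood: the first
coordinate runs along the knot and the second one around it. -/
abbrev Torus : Type := Circle × Circle

/-- The model solid torus `S¹ × D²`. -/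
abbrev SolidTorus : Type := Circle × Metric.closedBall (0 : ℂ) 1

/-- The inclusion of the torus as the boundary of the solid torus. -/
def torusToSolid : C(Torus, SolidTorus) where
  toFun p := (p.1, ⟨p.2, by simp [Circle.norm_coe]⟩)
  continuous_toFun := by fun_prop

/-- The map `v_K : H₁(∂V_K) → H₁(V_K)`, with `H₁(V_K)` infinite cyclic. -/
def valuation : H₁ Torus →ₗ[ℤ] H₁ SolidTorus := H₁.map torusToSolid

/-- A link with tame components in a `3`-manifold, indexed by `ι`: each component has a tubular
neighbourhood, parametrized by an open embedding of `S¹ × ℂ` that takes `S¹ × {0}` to it, and the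
components are pairwise disjoint. Tubular neighbourhoods of different components may meet each
other, and meet other components. -/
structure TameLink (M : Type) [TopologicalSpace M] (ι : Type) where
  tube : ι → Circle × ℂ → M
  isOpenEmbedding_tube : ∀ i, IsOpenEmbedding (tube i)
  disjoint_core : ∀ i j, i ≠ j → ∀ z w, tube i (z, 0) ≠ tube j (w, 0)

namespace TameLink

variable {M : Type} [TopologicalSpace M] {ι : Type} (𝒦 : TameLink M ι)

/-- The component `K_i`, as a map from the circle. -/
def knot (i : ι) : C(Circle, M) :=
  ⟨fun z => 𝒦.tube i (z, 0), (𝒦.isOpenEmbedding_tube i).continuous.comp (by fun_prop)⟩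

/-- The component `K_i`, as a subset. -/
def core (i : ι) : Set M := Set.range (𝒦.knot i)

/-- The underlying set of a finite sublink. -/
def support (F : Finset ι) : Set M := ⋃ i ∈ F, 𝒦.core i

/-- The closed tubular neighbourhood `V_i` of radius `r`. -/
def solid (i : ι) (r : ℝ) : Set M := 𝒦.tube i '' (Set.univ ×ˢ Metric.closedBall 0 r)

/-- The open tubular neighbourhood of radius `r`, the interior of `V_i`. -/
def openSolid (i : ι) (r : ℝ) : Set M := 𝒦.tube i '' (Set.univ ×ˢ Metric.ball 0 r)

/-- The torus `∂V_i` of radius `r`. -/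
def torus (i : ι) (r : ℝ) : Set M := 𝒦.tube i '' (Set.univ ×ˢ Metric.sphere 0 r)

/-- The link is admissible: its components generate `H₁(M)`. -/
def IsAdmissible : Prop := ⨆ i, LinearMap.range (H₁.map (𝒦.knot i)) = ⊤

/-- The parametrization of the solid torus of radius `r`. -/
def solidParam (i : ι) (r : ℝ) : C(SolidTorus, M) :=
  ⟨fun p => 𝒦.tube i (p.1, r * p.2),
    (𝒦.isOpenEmbedding_tube i).continuous.comp (by fun_prop)⟩

/-- The parametrization of the torus of radius `r`. -/
def torusParam (i : ι) (r : ℝ) : C(Torus, M) := (𝒦.solidParam i r).comp torusToSolid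

theorem torusParam_apply (i : ι) (r : ℝ) (p : Torus) :
    𝒦.torusParam i r p = 𝒦.tube i (p.1, r * p.2) := rfl

theorem solidParam_mem (i : ι) {r : ℝ} (hr : 0 < r) (p : SolidTorus) :
    𝒦.solidParam i r p ∈ 𝒦.solid i r := by
  refine ⟨_, ⟨trivial, ?_⟩, rfl⟩
  have := p.2.2
  simp only [mem_closedBall_zero_iff] at this ⊢
  rw [norm_mul, Complex.norm_real, Real.norm_of_nonneg hr.le]
  nlinarith

theorem torusParam_mem (i : ι) {r : ℝ} (hr : 0 < r) (p : Torus) :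
    𝒦.torusParam i r p ∈ 𝒦.torus i r := by
  refine ⟨_, ⟨trivial, ?_⟩, rfl⟩
  simp [torusToSolid, abs_of_pos hr, Circle.norm_coe]

theorem torus_subset_solid (i : ι) (r : ℝ) : 𝒦.torus i r ⊆ 𝒦.solid i r :=
  Set.image_mono (Set.prod_mono_right Metric.sphere_subset_closedBall)

theorem core_subset_solid (i : ι) {r : ℝ} (hr : 0 < r) : 𝒦.core i ⊆ 𝒦.solid i r := by
  rintro _ ⟨z, rfl⟩
  exact ⟨(z, 0), ⟨trivial, by simp [hr.le]⟩, rfl⟩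

theorem disjoint_torus_core (i : ι) {r : ℝ} (hr : 0 < r) :
    Disjoint (𝒦.torus i r) (𝒦.core i) := by
  rw [Set.disjoint_left]
  rintro _ ⟨⟨z, w⟩, ⟨-, hw⟩, rfl⟩ ⟨z', h⟩
  have := (𝒦.isOpenEmbedding_tube i).injective h
  simp only [Prod.mk.injEq] at this
  rw [← this.2] at hw
  simp only [Metric.mem_sphere, dist_self] at hw
  exact hr.ne hw

theorem isPathConnected_torus (i : ι) {r : ℝ} (hr : 0 < r) :
    IsPathConnected (𝒦.torus i r) := by
  have : 𝒦.torus i r = Set.range (𝒦.torusParam i r) := by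
    refine Set.Subset.antisymm ?_ (Set.range_subset_iff.2 (𝒦.torusParam_mem i hr))
    rintro _ ⟨⟨z, w⟩, ⟨-, hw⟩, rfl⟩
    have hw' : ‖w‖ = r := by simpa using hw
    have hr' : (r : ℂ) ≠ 0 := by exact_mod_cast hr.ne'
    refine ⟨(z, ⟨w / r, ?_⟩), ?_⟩
    · rw [Submonoid.unitSphere, Submonoid.mem_mk, Subsemigroup.mem_mk, mem_sphere_zero_iff_norm, norm_div, hw', Complex.norm_real, Real.norm_of_nonneg hr.le,
        div_self hr.ne']
    · rw [torusParam_apply]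
      congr 2
      exact mul_div_cancel₀ w hr'
  rw [this]
  exact isPathConnected_range (𝒦.torusParam i r).continuous

theorem isCompact_torus (i : ι) (r : ℝ) :
    IsCompact (𝒦.torus i r) :=
  (isCompact_univ.prod (isCompact_sphere _ _)).image (𝒦.isOpenEmbedding_tube i).continuous

theorem isCompact_core (i : ι) : IsCompact (𝒦.core i) :=
  isCompact_range (𝒦.knot i).continuous

/-- The tubular neighbourhood of `K_i` of radius `r` misses all other components of the finite
sublink `F`. -/
def IsThin (F : Finset ι) (i : ι) (r : ℝ) : Prop :=
  0 < r ∧ ∀ j ∈ F, j ≠ i → Disjoint (𝒦.solid i r) (𝒦.core j)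

theorem IsThin.mono {F F' : Finset ι} (h : F ⊆ F') {i : ι} {r : ℝ} (hr : 𝒦.IsThin F' i r) :
    𝒦.IsThin F i r := ⟨hr.1, fun j hj => hr.2 j (h hj)⟩

theorem exists_isThin [T2Space M] (F : Finset ι) (i : ι) : ∃ r, 𝒦.IsThin F i r := by
  classical
  have hcl : IsClosed (𝒦.support (F.erase i)) :=
    (F.erase i).finite_toSet.isClosed_biUnion fun j _ => (𝒦.isCompact_core j).isClosed
  have hU : IsOpen (𝒦.tube i ⁻¹' (𝒦.support (F.erase i))ᶜ) :=
    hcl.isOpen_compl.preimage (𝒦.isOpenEmbedding_tube i).continuous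
  obtain ⟨U, V, -, hV, hUU, h0, hUV⟩ := generalized_tube_lemma (s := (Set.univ : Set Circle))
    isCompact_univ (t := {(0 : ℂ)}) isCompact_singleton hU (by
      rintro ⟨z, w⟩ ⟨-, hw⟩
      obtain rfl : w = 0 := hw
      simp only [support, Set.mem_preimage, Set.mem_compl_iff, Set.mem_iUnion, not_exists]
      rintro j hj ⟨z', h⟩
      exact 𝒦.disjoint_core j i (Finset.ne_of_mem_erase hj) z' z h)
  obtain ⟨r, hr, hrV⟩ := Metric.nhds_basis_closedBall.mem_iff.1 (hV.mem_nhds (h0 rfl))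
  refine ⟨r, hr, fun j hj hji => Set.disjoint_left.2 ?_⟩
  rintro _ ⟨⟨z, w⟩, ⟨-, hw⟩, rfl⟩ hc
  exact hUV ⟨hUU trivial, hrV hw⟩
    (Set.mem_biUnion (show j ∈ F.erase i from Finset.mem_erase.2 ⟨hji, hj⟩) hc)

variable {𝒦} in
theorem IsThin.torus_subset {F : Finset ι} {i : ι} {r : ℝ} (hr : 𝒦.IsThin F i r) :
    𝒦.torus i r ⊆ (𝒦.support F)ᶜ := by
  intro x hx hxF
  simp only [support, Set.mem_iUnion] at hxF
  obtain ⟨j, hj, hxj⟩ := hxF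
  by_cases hji : j = i
  · subst hji
    exact Set.disjoint_left.1 (𝒦.disjoint_torus_core j hr.1) hx hxj
  · exact Set.disjoint_left.1 (hr.2 j hj hji) (𝒦.torus_subset_solid i r hx) hxj

variable {𝒦} in
theorem IsThin.solid_subset {F : Finset ι} {i : ι} {r : ℝ} (hr : 𝒦.IsThin F i r) (hi : i ∉ F) :
    𝒦.solid i r ⊆ (𝒦.support F)ᶜ := by
  intro x hx hxF
  simp only [support, Set.mem_iUnion] at hxF
  obtain ⟨j, hj, hxj⟩ := hxF
  exact Set.disjoint_left.1 (hr.2 j hj (fun h => hi (h ▸ hj))) hx hxj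

/-- The map `∂V_i → M - F` for a finite sublink `F` and a thin tubular neighbourhood of `K_i`. -/
def torusToCompl {F : Finset ι} {i : ι} {r : ℝ} (hr : 𝒦.IsThin F i r) :
    C(Torus, ↥(𝒦.support F)ᶜ) :=
  ⟨fun p => ⟨𝒦.torusParam i r p, hr.torus_subset (𝒦.torusParam_mem i hr.1 p)⟩,
    (𝒦.torusParam i r).continuous.subtype_mk _⟩

theorem torusToCompl_homotopic {F : Finset ι} {i : ι} {r r' : ℝ} (hr : 𝒦.IsThin F i r)
    (hr' : 𝒦.IsThin F i r') : (𝒦.torusToCompl hr).Homotopic (𝒦.torusToCompl hr') := by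
  have hthin (t : unitInterval) : 𝒦.IsThin F i ((1 - (t : ℝ)) * r + t * r') := by
    have h0 := t.2.1
    have h1 := t.2.2
    have hpos : 0 < (1 - (t : ℝ)) * r + t * r' := by
      have := hr.1
      have := hr'.1
      rcases h0.eq_or_lt with h | h
      · rw [← h]; simpa using hr.1
      · nlinarith [mul_pos h hr'.1, mul_nonneg (sub_nonneg.2 h1) hr.1.le]
    refine ⟨hpos, fun j hj hji => ?_⟩
    have hle : (1 - (t : ℝ)) * r + t * r' ≤ max r r' := by
      nlinarith [le_max_left r r', le_max_right r r',
        mul_le_mul_of_nonneg_left (le_max_left r r') (sub_nonneg.2 h1),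
        mul_le_mul_of_nonneg_left (le_max_right r r') h0]
    have hsub : 𝒦.solid i ((1 - (t : ℝ)) * r + t * r') ⊆ 𝒦.solid i (max r r') :=
      Set.image_mono (Set.prod_mono_right (Metric.closedBall_subset_closedBall hle))
    refine Disjoint.mono_left hsub ?_
    rcases max_choice r r' with h | h <;> rw [h]
    · exact hr.2 j hj hji
    · exact hr'.2 j hj hji
  refine ⟨⟨⟨fun q => ⟨𝒦.torusParam i ((1 - (q.1 : ℝ)) * r + q.1 * r') q.2,
    (hthin q.1).torus_subset (𝒦.torusParam_mem i (hthin q.1).1 q.2)⟩, ?_⟩, ?_, ?_⟩⟩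
  · refine Continuous.subtype_mk ?_ _
    simp only [torusParam_apply]
    exact (𝒦.isOpenEmbedding_tube i).continuous.comp (by fun_prop)
  · intro p
    apply Subtype.ext
    simp [torusToCompl]
  · intro p
    apply Subtype.ext
    simp [torusToCompl]

/-- The homomorphism `H₁(∂V_i) → H₁(M - F)`. -/
def localToCompl [T2Space M] (F : Finset ι) (i : ι) : H₁ Torus →ₗ[ℤ] H₁ ↥(𝒦.support F)ᶜ :=
  H₁.map (𝒦.torusToCompl (𝒦.exists_isThin F i).choose_spec)

/-- The homomorphism `H₁(∂V_i) → H₁(M - F)` does not depend on the choice of a thin tubular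
neighbourhood. -/
theorem localToCompl_eq [T2Space M] {F : Finset ι} {i : ι} {r : ℝ} (hr : 𝒦.IsThin F i r) :
    𝒦.localToCompl F i = H₁.map (𝒦.torusToCompl hr) :=
  H₁.map_congr_of_homotopic (𝒦.torusToCompl_homotopic _ hr)

theorem localToCompl_eq_zero [T2Space M] {F : Finset ι} {i : ι} (hi : i ∉ F) {a : H₁ Torus}
    (ha : valuation a = 0) : 𝒦.localToCompl F i a = 0 := by
  obtain ⟨r, hr⟩ := 𝒦.exists_isThin F i
  let g : C(SolidTorus, ↥(𝒦.support F)ᶜ) :=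
    ⟨fun p => ⟨𝒦.solidParam i r p, hr.solid_subset hi (𝒦.solidParam_mem i hr.1 p)⟩,
      (𝒦.solidParam i r).continuous.subtype_mk _⟩
  have : 𝒦.torusToCompl hr = g.comp torusToSolid := rfl
  rw [𝒦.localToCompl_eq hr, this, H₁.map_comp]
  change H₁.map g (valuation a) = 0
  rw [ha, map_zero]

theorem support_mono {F F' : Finset ι} (h : F ⊆ F') : 𝒦.support F ⊆ 𝒦.support F' :=
  Set.biUnion_subset_biUnion_left h

theorem map_localToCompl [T2Space M] {F F' : Finset ι} (h : F ⊆ F') (i : ι) (a : H₁ Torus) :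
    H₁.map (incl (Set.compl_subset_compl.2 (𝒦.support_mono h))) (𝒦.localToCompl F' i a) =
      𝒦.localToCompl F i a := by
  obtain ⟨r, hr⟩ := 𝒦.exists_isThin F' i
  rw [𝒦.localToCompl_eq hr, 𝒦.localToCompl_eq (hr.mono 𝒦 h), ← H₁.map_comp]
  rfl

/-! ### Ideles -/

/-- The idele group: the restricted product of the groups `H₁(∂V_i)` with respect to the kernels
of `v_i`. -/
def ideleGroup (_𝒦 : TameLink M ι) : AddSubgroup (ι → H₁ Torus) where
  carrier := {a | {i | valuation (a i) ≠ 0}.Finite}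
  zero_mem' := by simp
  add_mem' {a b} ha hb := (ha.union hb).subset fun i hi => by
    by_contra h
    simp only [Set.mem_union, Set.mem_ofPred_eq, not_or, not_not] at h
    exact hi (by simp [h.1, h.2])
  neg_mem' {a} ha := by simpa using ha

/-- The group `H₁(M - 𝒦)`: the inverse limit of the groups `H₁(M - F)` over the finite
sublinks `F`. -/
def complH₁ : AddSubgroup (∀ F : Finset ι, H₁ ↥(𝒦.support F)ᶜ) where
  carrier := {x | ∀ F F' (h : F ⊆ F'),
    H₁.map (incl (Set.compl_subset_compl.2 (𝒦.support_mono h))) (x F') = x F}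
  zero_mem' := by intro F F' h; simp
  add_mem' ha hb := by intro F F' h; simp [ha F F' h, hb F F' h]
  neg_mem' ha := by intro F F' h; simp [ha F F' h]

theorem finite_localToCompl_ne_zero [T2Space M] (F : Finset ι) (α : 𝒦.ideleGroup) :
    (Function.support fun i => 𝒦.localToCompl F i (α.1 i)).Finite := by
  refine (F.finite_toSet.union α.2).subset fun i hi => ?_
  by_contra h
  simp only [Set.mem_union, Set.mem_ofPred_eq, not_or, not_not, Finset.mem_coe] at h
  exact hi (𝒦.localToCompl_eq_zero h.1 h.2)

/-- The global reciprocity map `ρ : J → H₁(M - 𝒦)`; its component in `H₁(M - F)` is the sum of the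
images of the local components of the idele, a finite sum. -/
def globalReciprocity [T2Space M] : 𝒦.ideleGroup →+ 𝒦.complH₁ where
  toFun α := ⟨fun F => ∑ᶠ i, 𝒦.localToCompl F i (α.1 i), fun F F' h => by
    have := (H₁.map (incl (Set.compl_subset_compl.2
      (𝒦.support_mono h)))).toAddMonoidHom.map_finsum (𝒦.finite_localToCompl_ne_zero F' α)
    refine this.trans (finsum_congr fun i => 𝒦.map_localToCompl h i _)⟩
  map_zero' := by
    apply Subtype.ext
    funext F
    simp
  map_add' α β := by
    apply Subtype.ext
    funext F
    refine (finsum_congr fun i => ?_).trans (finsum_add_distrib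
      (𝒦.finite_localToCompl_ne_zero F α) (𝒦.finite_localToCompl_ne_zero F β))
    exact map_add _ _ _

end TameLink
namespace TameLink

variable {M : Type} [TopologicalSpace M] {ι : Type} (𝒦 : TameLink M ι)

/-! ### Principal ideles -/

/-- The radii `r` give pairwise disjoint tubular neighbourhoods of the components of `F`. -/
def IsTubeSystem (F : Finset ι) (r : ι → ℝ) : Prop :=
  (∀ i ∈ F, 0 < r i) ∧
    ∀ i ∈ F, ∀ j ∈ F, i ≠ j → Disjoint (𝒦.solid i (r i)) (𝒦.solid j (r j))

/-- The union `V` of the closed tubular neighbourhoods of the components of `F`. -/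
def tubes (F : Finset ι) (r : ι → ℝ) : Set M := ⋃ i ∈ F, 𝒦.solid i (r i)

/-- The union `∂V` of the boundary tori. -/
def tubesBoundary (F : Finset ι) (r : ι → ℝ) : Set M := ⋃ i ∈ F, 𝒦.torus i (r i)

/-- The exterior `M - Int V`. -/
def exterior (F : Finset ι) (r : ι → ℝ) : Set M := (⋃ i ∈ F, 𝒦.openSolid i (r i))ᶜ

theorem tubesBoundary_subset_tubes (F : Finset ι) (r : ι → ℝ) :
    𝒦.tubesBoundary F r ⊆ 𝒦.tubes F r :=
  Set.iUnion₂_mono fun i _ => 𝒦.torus_subset_solid i (r i)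

variable {𝒦} in
theorem IsTubeSystem.support_subset {F : Finset ι} {r : ι → ℝ} (hr : 𝒦.IsTubeSystem F r) :
    𝒦.support F ⊆ 𝒦.tubes F r :=
  Set.iUnion₂_mono fun i hi => 𝒦.core_subset_solid i (hr.1 i hi)

variable {𝒦} in
theorem IsTubeSystem.boundary_subset {F : Finset ι} {r : ι → ℝ} (hr : 𝒦.IsTubeSystem F r) :
    𝒦.tubesBoundary F r ⊆ 𝒦.exterior F r := by
  intro x hx hx'
  simp only [tubesBoundary, Set.mem_iUnion] at hx hx'
  obtain ⟨i, hi, hxi⟩ := hx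
  obtain ⟨j, hj, hxj⟩ := hx'
  by_cases hij : i = j
  · subst hij
    obtain ⟨p, ⟨-, hp⟩, rfl⟩ := hxi
    obtain ⟨q, ⟨-, hq⟩, h⟩ := hxj
    rw [(𝒦.isOpenEmbedding_tube i).injective h] at hq
    simp only [Metric.mem_sphere, Metric.mem_ball] at hp hq
    exact hq.ne hp
  · refine Set.disjoint_left.1 (hr.2 i hi j hj hij) (𝒦.torus_subset_solid i _ hxi) ?_
    exact Set.image_mono (Set.prod_mono_right Metric.ball_subset_closedBall) hxj

/-- The parametrization of the torus `∂V_i` of radius `r`, as a map to the torus. -/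
def torusToTorus (i : ι) {r : ℝ} (hr : 0 < r) : C(Torus, 𝒦.torus i r) :=
  ⟨fun p => ⟨𝒦.torusParam i r p, 𝒦.torusParam_mem i hr p⟩,
    (𝒦.torusParam i r).continuous.subtype_mk _⟩

/-- The inclusion of the torus `∂V_i` in `∂V`. -/
def torusToBoundary {F : Finset ι} {r : ι → ℝ} (hr : 𝒦.IsTubeSystem F r) (i : F) :
    C(Torus, 𝒦.tubesBoundary F r) :=
  (incl (Set.subset_biUnion_of_mem (u := fun i => 𝒦.torus i (r i)) i.2)).comp
    (𝒦.torusToTorus i (hr.1 i i.2))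

/-- The homomorphism `H₂(M, F) → H₂(M, V)` for a finite sublink `F`, and more generally
`H₂(M, F₀) → H₂(M, V)` for `F₀ ⊆ F`. -/
def toTubes {F₀ F : Finset ι} (h : F₀ ⊆ F) {r : ι → ℝ} (hr : 𝒦.IsTubeSystem F r) :
    relH₂ (Set.subset_univ (𝒦.support F₀)) →ₗ[ℤ] relH₂ (Set.subset_univ (𝒦.tubes F r)) :=
  relMap _ _ ((𝒦.support_mono h).trans hr.support_subset) subset_rfl

/-- The excision homomorphism `H₂(M - Int V, ∂V) → H₂(M, V)`. -/
def excision {F : Finset ι} {r : ι → ℝ} (hr : 𝒦.IsTubeSystem F r) :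
    relH₂ hr.boundary_subset →ₗ[ℤ] relH₂ (Set.subset_univ (𝒦.tubes F r)) :=
  relMap _ _ (𝒦.tubesBoundary_subset_tubes F r) (Set.subset_univ _)

/-- The graph of the map `Δ : H₂(M, 𝒦) = colim H₂(M, F₀) → J`: the idele `α` is the image under `Δ`
of the class of `a ∈ H₂(M, F₀)`. For all larger finite sublinks `F`, the components of `α` at `F`
are the image of `a` under
`H₂(M, F₀) → H₂(M, F) ≅ H₂(M, V) ≅ H₂(M - Int V, ∂V) → H₁(∂V) = ⨁ H₁(∂V_i)`,
where the last isomorphism is inverse to excision and the last map is the boundary map. -/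
def IsDelta {F₀ : Finset ι} (a : relH₂ (Set.subset_univ (𝒦.support F₀))) (α : ι → H₁ Torus) :
    Prop :=
  ∀ (F : Finset ι) (hF : F₀ ⊆ F) (r : ι → ℝ) (hr : 𝒦.IsTubeSystem F r),
    ∃ c : relH₂ hr.boundary_subset,
      𝒦.excision hr c = 𝒦.toTubes hF hr a ∧
      relBoundary hr.boundary_subset c = ∑ i : F, H₁.map (𝒦.torusToBoundary hr i) (α i)

variable {𝒦} in
theorem IsDelta.extend {F₀ F₁ : Finset ι} (h : F₀ ⊆ F₁)
    {a : relH₂ (Set.subset_univ (𝒦.support F₀))} {α : ι → H₁ Torus} (ha : 𝒦.IsDelta a α) :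
    𝒦.IsDelta (F₀ := F₁)
      (relMap _ _ (𝒦.support_mono h) subset_rfl a) α := by
  intro F hF r hr
  obtain ⟨c, h1, h2⟩ := ha F (h.trans hF) r hr
  exact ⟨c, h1.trans (relMap_relMap ..).symm, h2⟩

/-- The group of principal ideles, the image of `Δ : H₂(M, 𝒦) → J`. -/
def principalIdeles : AddSubgroup 𝒦.ideleGroup where
  carrier := {α | ∃ (F₀ : Finset ι) (a : relH₂ (Set.subset_univ (𝒦.support F₀))),
    𝒦.IsDelta a α.1}
  zero_mem' := ⟨∅, 0, fun F hF r hr => ⟨0, by simp, by simp⟩⟩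
  add_mem' := by
    classical
    rintro α β ⟨F₀, a, ha⟩ ⟨F₁, b, hb⟩
    refine ⟨F₀ ∪ F₁, relMap _ _ (𝒦.support_mono Finset.subset_union_left) subset_rfl a +
      relMap _ _ (𝒦.support_mono Finset.subset_union_right) subset_rfl b, fun F hF r hr => ?_⟩
    obtain ⟨c, h1, h2⟩ := ha.extend Finset.subset_union_left F hF r hr
    obtain ⟨d, h3, h4⟩ := hb.extend Finset.subset_union_right F hF r hr
    refine ⟨c + d, by rw [map_add, map_add, h1, h3], ?_⟩
    rw [map_add, h2, h4, ← Finset.sum_add_distrib]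
    exact Finset.sum_congr rfl fun i _ => (map_add _ _ _).symm
  neg_mem' := by
    rintro α ⟨F₀, a, ha⟩
    refine ⟨F₀, -a, fun F hF r hr => ?_⟩
    obtain ⟨c, h1, h2⟩ := ha F hF r hr
    refine ⟨-c, by rw [map_neg, map_neg, h1], ?_⟩
    rw [map_neg, h2, ← Finset.sum_neg_distrib]
    exact Finset.sum_congr rfl fun i _ => (map_neg _ _).symm

end TameLink

/-! ### Deck transformations -/

/-- The group of deck transformations of a map: the homeomorphisms of the source over the
target. -/
def DeckGroup {Y X : Type} [TopologicalSpace Y] (p : Y → X) : Subgroup (Y ≃ₜ Y) where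
  carrier := {f | ∀ y, p (f y) = p y}
  mul_mem' {f g} hf hg y := (hf (g y)).trans (hg y)
  one_mem' _ := rfl
  inv_mem' {f} hf y := by
    have := hf (f⁻¹ y)
    rwa [show f (f⁻¹ y) = y from f.apply_symm_apply y, eq_comm] at this

instance {Y X : Type} [TopologicalSpace Y] (p : Y → X) : MulAction (DeckGroup p) Y where
  smul g y := g.1 y
  one_smul _ := rfl
  mul_smul _ _ _ := rfl

/-- A map is the quotient covering of a group action as soon as it is a locally injective
quotient map and the action is continuous, free, and has the fibres as orbits. -/
theorem isQuotientCoveringMap_of_free {Y X : Type} [TopologicalSpace Y] [TopologicalSpace X]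
    {p : Y → X} {G : Type} [Group G] [MulAction G Y] (hp : IsQuotientMap p)
    (hc : ∀ g : G, Continuous fun y : Y => g • y)
    (horb : ∀ y y', p y = p y' ↔ ∃ g : G, g • y' = y)
    (hfree : ∀ (g : G) (y : Y), g • y = y → g = 1)
    (hinj : ∀ y, ∃ U ∈ 𝓝 y, Set.InjOn p U) : IsQuotientCoveringMap p G where
  toIsQuotientMap := hp
  continuous_const_smul := hc
  apply_eq_iff_mem_orbit := horb _ _
  disjoint y := by
    obtain ⟨U, hU, hUi⟩ := hinj y
    refine ⟨U, hU, ?_⟩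
    rintro g ⟨_, ⟨u, hu, rfl⟩, hu'⟩
    exact hfree g u (hUi hu' hu ((horb _ _).2 ⟨g, rfl⟩))

/-! ### Branched covers -/

/-- A finite abelian cover `h : N → M` of a `3`-manifold by a closed `3`-manifold, branched along
(a part of) `B`. Outside `B` it is a connected finite covering; near each point over `B` it is,
in suitable coordinates `(t, w) ∈ ℝ × ℂ` in which `B` is the line `w = 0`, the map
`(t, w) ↦ (t, w ^ e)`; its group of deck transformations is commutative and acts transitively on
the fibres outside `B`. -/
structure AbelianBranchedCover (M : Type) [TopologicalSpace M] (B : Set M) where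
  N : Type
  [topologicalSpace : TopologicalSpace N]
  [t2Space : T2Space N]
  [compactSpace : CompactSpace N]
  [chartedSpace : ChartedSpace (EuclideanSpace ℝ (Fin 3)) N]
  map : N → M
  continuous_map : Continuous map
  surjective_map : Function.Surjective map
  finite_fibre : ∀ x, (map ⁻¹' {x}).Finite
  isCoveringMapOn : IsCoveringMapOn map Bᶜ
  isConnected_unbranched : IsConnected (map ⁻¹' Bᶜ)
  exists_coordinates : ∀ y, map y ∈ B → ∃ (e : ℕ) (φ : OpenPartialHomeomorph N (ℝ × ℂ))
    (ψ : OpenPartialHomeomorph M (ℝ × ℂ)), 0 < e ∧ y ∈ φ.source ∧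
      (∀ x ∈ ψ.source, x ∈ B ↔ (ψ x).2 = 0) ∧
      ∀ z ∈ φ.source, map z ∈ ψ.source ∧ ψ (map z) = ((φ z).1, (φ z).2 ^ e)
  exists_deck : ∀ y y', map y ∉ B → map y' = map y → ∃ g ∈ DeckGroup map, g y = y'
  deck_comm : ∀ f ∈ DeckGroup map, ∀ g ∈ DeckGroup map, f * g = g * f

attribute [instance] AbelianBranchedCover.topologicalSpace AbelianBranchedCover.t2Space
  AbelianBranchedCover.compactSpace AbelianBranchedCover.chartedSpace

namespace AbelianBranchedCover

variable {M : Type} [TopologicalSpace M] {B : Set M} (h : AbelianBranchedCover M B)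

/-- The Galois group `Gal(h)`, the group of deck transformations of `h : N → M`. -/
abbrev Gal : Type := DeckGroup h.map

instance : CommGroup h.Gal :=
  { (inferInstance : Group (DeckGroup h.map)) with
    mul_comm := fun f g => Subtype.ext (h.deck_comm f f.2 g g.2) }

/-- The restriction of `h` to the part over `M - B`. -/
abbrev unbranched : h.map ⁻¹' Bᶜ → (Bᶜ : Set M) := Bᶜ.restrictPreimage h.map

theorem isCoveringMap_unbranched : IsCoveringMap h.unbranched :=
  h.isCoveringMapOn.isCoveringMap_restrictPreimage

instance : MulAction h.Gal (h.map ⁻¹' Bᶜ) where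
  smul g y := ⟨g.1 y, by
    have := y.2
    rwa [Set.mem_preimage, g.2 y.1]⟩
  one_smul _ := rfl
  mul_smul _ _ _ := rfl

theorem lift_unique {A : Type} [TopologicalSpace A] [PreconnectedSpace A] {f g : A → h.N}
    (hf : Continuous f) (hg : Continuous g) (hfB : ∀ a, h.map (f a) ∈ Bᶜ)
    (hfg : ∀ a, h.map (g a) = h.map (f a)) {a : A} (ha : f a = g a) : f = g := by
  have hgB : ∀ a, h.map (g a) ∈ Bᶜ := fun a => by rw [hfg]; exact hfB a
  have := h.isCoveringMap_unbranched.eq_of_comp_eq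
    (g₁ := fun a => (⟨f a, hfB a⟩ : h.map ⁻¹' Bᶜ)) (g₂ := fun a => ⟨g a, hgB a⟩)
    (hf.subtype_mk _) (hg.subtype_mk _) (funext fun a => Subtype.ext (hfg a).symm) a
    (Subtype.ext ha)
  funext a
  exact congrArg Subtype.val (congrFun this a)

theorem dense_unbranched : Dense (h.map ⁻¹' Bᶜ) := by
  rw [← compl_compl (h.map ⁻¹' Bᶜ), ← interior_eq_empty_iff_dense_compl,
    Set.eq_empty_iff_forall_notMem]
  intro y hy
  have hyB : h.map y ∈ B := by
    have := interior_subset hy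
    simpa using this
  obtain ⟨e, φ, ψ, he, hyφ, hψ, hφ⟩ := h.exists_coordinates y hyB
  have hW : φ '' (φ.source ∩ interior (h.map ⁻¹' Bᶜ)ᶜ) ∈ 𝓝 (φ y) :=
    (φ.isOpen_image_source_inter isOpen_interior).mem_nhds ⟨y, ⟨hyφ, hy⟩, rfl⟩
  have hsub : φ '' (φ.source ∩ interior (h.map ⁻¹' Bᶜ)ᶜ) ⊆ {q | q.2 = 0} := by
    rintro _ ⟨z, ⟨hz, hz'⟩, rfl⟩
    have hzB : h.map z ∈ B := by simpa using interior_subset hz'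
    have h1 := (hψ _ (hφ z hz).1).1 hzB
    rw [(hφ z hz).2] at h1
    exact pow_eq_zero_iff he.ne' |>.1 h1
  have hcont : Filter.Tendsto (fun t : ℝ => ((φ y).1, (t : ℂ))) (𝓝[≠] 0) (𝓝 (φ y)) := by
    have h0 : φ y = ((φ y).1, ((0 : ℝ) : ℂ)) :=
      Prod.ext rfl (by simpa using hsub ⟨y, ⟨hyφ, hy⟩, rfl⟩)
    have hc : Continuous fun t : ℝ => ((φ y).1, (t : ℂ)) := by fun_prop
    have := hc.tendsto 0
    rw [← h0] at this
    exact this.mono_left nhdsWithin_le_nhds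
  obtain ⟨t, ht, ht0⟩ := ((hcont.eventually hW).and self_mem_nhdsWithin).exists
  exact ht0 (by simpa using hsub ht)

theorem gal_ext {g g' : h.Gal} {y : h.N} (hy : h.map y ∈ Bᶜ) (hg : g.1 y = g'.1 y) : g = g' := by
  have : PreconnectedSpace (h.map ⁻¹' Bᶜ) :=
    isPreconnected_iff_preconnectedSpace.1 h.isConnected_unbranched.isPreconnected
  have h1 := h.lift_unique (A := h.map ⁻¹' Bᶜ) (f := fun z => g.1 z) (g := fun z => g'.1 z)
    (g.1.continuous.comp continuous_subtype_val) (g'.1.continuous.comp continuous_subtype_val)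
    (fun z => by rw [g.2]; exact z.2) (fun z => by rw [g.2, g'.2]) (a := ⟨y, hy⟩) hg
  apply Subtype.ext
  apply Homeomorph.ext
  refine congrFun (Continuous.ext_on h.dense_unbranched g.1.continuous g'.1.continuous ?_)
  intro z hz
  exact congrFun h1 ⟨z, hz⟩

theorem exists_injOn {y : h.N} (hy : h.map y ∈ Bᶜ) : ∃ U ∈ 𝓝 y, Set.InjOn h.map U := by
  obtain ⟨φ, hφ, heq⟩ := h.isCoveringMapOn.isLocalHomeomorphOn y hy
  exact ⟨φ.source, φ.open_source.mem_nhds hφ, heq ▸ φ.injOn⟩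

theorem isQuotientCoveringMap_unbranched : IsQuotientCoveringMap h.unbranched h.Gal := by
  refine isQuotientCoveringMap_of_free (h.isCoveringMap_unbranched.isQuotientMap ?_) ?_ ?_ ?_ ?_
  · rintro ⟨x, hx⟩
    obtain ⟨y, rfl⟩ := h.surjective_map x
    exact ⟨⟨y, hx⟩, rfl⟩
  · intro g
    exact (g.1.continuous.comp continuous_subtype_val).subtype_mk _
  · intro y y'
    constructor
    · intro hyy
      obtain ⟨g, hg, hgy⟩ := h.exists_deck y' y y'.2 (congrArg Subtype.val hyy)
      exact ⟨⟨g, hg⟩, Subtype.ext hgy⟩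
    · rintro ⟨g, rfl⟩
      exact Subtype.ext (g.2 y'.1)
  · intro g y hg
    exact h.gal_ext y.2 (congrArg Subtype.val hg)
  · intro y
    obtain ⟨U, hU, hUi⟩ := h.exists_injOn y.2
    exact ⟨Subtype.val ⁻¹' U, continuous_subtype_val.continuousAt.preimage_mem_nhds hU,
      fun a ha b hb hab => Subtype.ext (hUi ha hb (congrArg Subtype.val hab))⟩

/-! ### The restriction of a branched cover to a subspace -/

section Restriction

variable {T : Set M} {y : h.N}

/-- A connected component of `h⁻¹(T)`: the one that contains `y`. -/
def component (T : Set M) (y : h.N) : Set h.N := connectedComponentIn (h.map ⁻¹' T) y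

theorem component_subset : h.component T y ⊆ h.map ⁻¹' T := connectedComponentIn_subset _ _

/-- The restriction of `h` to a connected component of `h⁻¹(T)`, as a map to `T`. -/
def restrict (T : Set M) (y : h.N) : h.component T y → T :=
  fun z => ⟨h.map z, h.component_subset z.2⟩

theorem continuous_restrict : Continuous (h.restrict T y) :=
  (h.continuous_map.comp continuous_subtype_val).subtype_mk _

instance : PreconnectedSpace (h.component T y) :=
  isPreconnected_iff_preconnectedSpace.1 isPreconnected_connectedComponentIn

theorem image_component {g : h.Gal} {z : h.N} (hz : z ∈ h.component T y)
    (hgz : g.1 z ∈ h.component T y) {w : h.N} (hw : w ∈ h.component T y) :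
    g.1 w ∈ h.component T y := by
  have hpre : IsPreconnected (g.1 '' h.component T y) :=
    isPreconnected_connectedComponentIn.image _ g.1.continuous.continuousOn
  have hsub : g.1 '' h.component T y ⊆ h.map ⁻¹' T := by
    rintro _ ⟨v, hv, rfl⟩
    rw [Set.mem_preimage, g.2]
    exact h.component_subset hv
  have := hpre.subset_connectedComponentIn (Set.mem_image_of_mem _ hz) hsub
  rw [component, connectedComponentIn_eq hgz]
  exact this ⟨w, hw, rfl⟩

/-- A deck transformation of `h` that takes some point of a component of `h⁻¹(T)` into the
component restricts to a deck transformation of the component. -/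
theorem exists_restrict {g : h.Gal} {z : h.N} (hz : z ∈ h.component T y)
    (hgz : g.1 z ∈ h.component T y) :
    ∃ f : DeckGroup (h.restrict T y), ∀ w, (f.1 w : h.N) = g.1 w := by
  have hinv {w : h.N} (hw : w ∈ h.component T y) : g⁻¹.1 w ∈ h.component T y :=
    h.image_component (g := g⁻¹) hgz (by
      rwa [show g⁻¹.1 (g.1 z) = z from g.1.symm_apply_apply z]) hw
  refine ⟨⟨⟨⟨fun w => ⟨g.1 w, h.image_component hz hgz w.2⟩,
    fun w => ⟨g⁻¹.1 w, hinv w.2⟩,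
    fun w => Subtype.ext (g.1.symm_apply_apply _), fun w => Subtype.ext (g.1.apply_symm_apply _)⟩,
    (g.1.continuous.comp continuous_subtype_val).subtype_mk _,
    (g⁻¹.1.continuous.comp continuous_subtype_val).subtype_mk _⟩,
    fun w => Subtype.ext (g.2 w.1)⟩, fun w => rfl⟩

theorem deck_ext (hT : T ⊆ Bᶜ) {f f' : DeckGroup (h.restrict T y)} {z : h.component T y}
    (hf : f.1 z = f'.1 z) : f = f' := by
  have hmap (f : DeckGroup (h.restrict T y)) (w) : h.map (f.1 w) = h.map w :=
    congrArg Subtype.val (f.2 w)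
  have h1 := h.lift_unique (A := h.component T y) (f := fun z => (f.1 z : h.N))
    (g := fun z => f'.1 z)
    (continuous_subtype_val.comp f.1.continuous) (continuous_subtype_val.comp f'.1.continuous)
    (fun z => hT (h.component_subset (f.1 z).2))
    (fun z => by rw [hmap, hmap]) (a := z) (congrArg Subtype.val hf)
  apply Subtype.ext
  apply Homeomorph.ext
  exact fun w => Subtype.ext (congrFun h1 w)

theorem existsUnique_extend (hT : T ⊆ Bᶜ) (hy : h.map y ∈ T)
    (f : DeckGroup (h.restrict T y)) :
    ∃! g : h.Gal, ∀ w : h.component T y, g.1 w = f.1 w := by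
  have hmap (f : DeckGroup (h.restrict T y)) (w) : h.map (f.1 w) = h.map w :=
    congrArg Subtype.val (f.2 w)
  let y₀ : h.component T y := ⟨y, mem_connectedComponentIn hy⟩
  obtain ⟨g, hg, hgy⟩ := h.exists_deck y (f.1 y₀) (hT hy) (hmap f y₀)
  refine ⟨⟨g, hg⟩, ?_, fun g' hg' => h.gal_ext (hT hy) ((hg' y₀).trans hgy.symm)⟩
  obtain ⟨f', hf'⟩ := h.exists_restrict (g := ⟨g, hg⟩) y₀.2 (by
    change g y ∈ _
    rw [hgy]; exact (f.1 y₀).2)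
  have : f' = f := h.deck_ext hT (z := y₀) (Subtype.ext ((hf' y₀).trans hgy))
  intro w
  rw [← this]
  exact (hf' w).symm

/-- The natural map from the group of deck transformations of a component of `h⁻¹(T)` over `T` to
`Gal(h)`: it takes a deck transformation to its unique extension. -/
def extend (hT : T ⊆ Bᶜ) (hy : h.map y ∈ T) : DeckGroup (h.restrict T y) →* h.Gal where
  toFun f := (h.existsUnique_extend hT hy f).choose
  map_one' := ((h.existsUnique_extend hT hy 1).choose_spec.2 1 fun _ => rfl).symm
  map_mul' f f' := by
    refine ((h.existsUnique_extend hT hy (f * f')).choose_spec.2 _ fun w => ?_).symm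
    have h1 := (h.existsUnique_extend hT hy f).choose_spec.1
    have h2 := (h.existsUnique_extend hT hy f').choose_spec.1
    change (h.existsUnique_extend hT hy f).choose.1
      ((h.existsUnique_extend hT hy f').choose.1 w) = _
    rw [h2, h1]
    rfl

theorem extend_apply (hT : T ⊆ Bᶜ) (hy : h.map y ∈ T) (f : DeckGroup (h.restrict T y))
    (w : h.component T y) : (h.extend hT hy f).1 w = f.1 w :=
  (h.existsUnique_extend hT hy f).choose_spec.1 w

theorem extend_injective (hT : T ⊆ Bᶜ) (hy : h.map y ∈ T) :
    Function.Injective (h.extend hT hy) := by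
  intro f f' hff
  refine h.deck_ext hT (z := ⟨y, mem_connectedComponentIn hy⟩) (Subtype.ext ?_)
  rw [← h.extend_apply hT hy, hff, h.extend_apply hT hy]

/-- The group of deck transformations of a component of `h⁻¹(T)` over `T` is commutative. -/
@[reducible]
def deckCommGroup (hT : T ⊆ Bᶜ) (hy : h.map y ∈ T) : CommGroup (DeckGroup (h.restrict T y)) :=
  { (inferInstance : Group (DeckGroup (h.restrict T y))) with
    mul_comm := fun f f' => h.extend_injective hT hy (by
      rw [map_mul, map_mul, mul_comm]) }

theorem surjective_restrict (hT : T ⊆ Bᶜ) (hy : h.map y ∈ T) (hTp : IsPathConnected T) :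
    Function.Surjective (h.restrict T y) := by
  rintro ⟨x, hx⟩
  obtain ⟨γ, hγ⟩ := hTp.joinedIn _ hy _ hx
  let γ' : C(unitInterval, (Bᶜ : Set M)) := ⟨fun t => ⟨γ t, hT (hγ t)⟩,
    γ.continuous.subtype_mk _⟩
  obtain ⟨Γ, hΓ, hΓ0⟩ := h.isCoveringMap_unbranched.exists_path_lifts γ' ⟨y, hT hy⟩
    (Subtype.ext (by simp [γ']))
  have hΓ' (t) : h.map (Γ t) = γ t := congrArg Subtype.val (congrFun hΓ t)
  have hmem : (Γ 1 : h.N) ∈ h.component T y := by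
    have hpre : IsPreconnected (Set.range fun t => (Γ t : h.N)) :=
      isPreconnected_range (continuous_subtype_val.comp Γ.continuous)
    refine hpre.subset_connectedComponentIn ⟨0, by simp [hΓ0]⟩ ?_ ⟨1, rfl⟩
    rintro _ ⟨t, rfl⟩
    rw [Set.mem_preimage, hΓ']
    exact hγ t
  exact ⟨⟨Γ 1, hmem⟩, Subtype.ext (by simp [restrict, hΓ'])⟩

theorem isQuotientCoveringMap_restrict [T2Space M] (hT : T ⊆ Bᶜ) (hy : h.map y ∈ T)
    (hTp : IsPathConnected T) (hTc : IsCompact T) :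
    IsQuotientCoveringMap (h.restrict T y) (DeckGroup (h.restrict T y)) := by
  have hcl : IsClosed (h.component T y) := by
    have h1 : IsClosed (h.map ⁻¹' T) := hTc.isClosed.preimage h.continuous_map
    rw [component, connectedComponentIn_eq_image (show y ∈ h.map ⁻¹' T from hy)]
    exact h1.isClosedEmbedding_subtypeVal.isClosedMap _ isClosed_connectedComponent
  have : CompactSpace (h.component T y) := isCompact_iff_compactSpace.1 hcl.isCompact
  refine isQuotientCoveringMap_of_free ?_ ?_ ?_ ?_ ?_
  · exact h.continuous_restrict.isClosedMap.isQuotientMap h.continuous_restrict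
      (h.surjective_restrict hT hy hTp)
  · exact fun g => g.1.continuous
  · intro z z'
    constructor
    · intro hzz
      obtain ⟨g, hg, hgz⟩ := h.exists_deck z' z (hT (h.component_subset z'.2))
        (congrArg Subtype.val hzz)
      obtain ⟨f, hf⟩ := h.exists_restrict (g := ⟨g, hg⟩) z'.2 (by
        change g z' ∈ _
        rw [hgz]; exact z.2)
      exact ⟨f, Subtype.ext ((hf z').trans hgz)⟩
    · rintro ⟨f, rfl⟩
      exact f.2 z'
  · intro f z hf
    exact h.deck_ext hT (z := z) hf
  · intro z
    obtain ⟨U, hU, hUi⟩ := h.exists_injOn (hT (h.component_subset z.2))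
    exact ⟨Subtype.val ⁻¹' U, continuous_subtype_val.continuousAt.preimage_mem_nhds hU,
      fun a ha b hb hab => Subtype.ext (hUi ha hb (congrArg Subtype.val hab))⟩

/-- The local reciprocity homomorphism `H₁(T) → Gal(h|T)`. -/
def localReciprocity [T2Space M] (hT : T ⊆ Bᶜ) (hy : h.map y ∈ T)
    (hTp : IsPathConnected T) (hTc : IsCompact T) :
    H₁ T →+ Additive (DeckGroup (h.restrict T y)) :=
  letI := h.deckCommGroup hT hy
  reciprocity (h.isQuotientCoveringMap_restrict hT hy hTp hTc)

end Restriction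
end AbelianBranchedCover

/-! ### Norm residue symbols -/

section Symbols

variable {M : Type} [TopologicalSpace M] [T2Space M] {ι : Type} {𝒦 : TameLink M ι}

/-- The global norm residue symbol `(α, h) ∈ Gal(h)` of an idele `α` and an abelian cover `h`
branched along a finite sublink `L`: the composition of the reciprocity map `J → H₁(M - 𝒦)`, the
projection `H₁(M - 𝒦) → H₁(M - L)` and the reciprocity map `H₁(M - L) → Gal(h)`. -/
def normResidueSymbol {L : Finset ι} (h : AbelianBranchedCover M (𝒦.support L))
    (α : 𝒦.ideleGroup) : h.Gal :=
  (reciprocity h.isQuotientCoveringMap_unbranched ((𝒦.globalReciprocity α).1 L)).toMul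

variable {L : Finset ι} (h : AbelianBranchedCover M (𝒦.support L)) {i : ι} {r : ℝ}
  (hr : 𝒦.IsThin L i r) {y : h.N} (hy : h.map y ∈ 𝒦.torus i r)

/-- The cover `h_K`: the restriction of `h` to a component of `h⁻¹(∂V_K)`. -/
abbrev localCover (i : ι) (r : ℝ) (y : h.N) : h.component (𝒦.torus i r) y → 𝒦.torus i r :=
  h.restrict (𝒦.torus i r) y

/-- The local norm residue symbol `(a, h_K) ∈ Gal(h_K)` of `a ∈ H₁(∂V_K)`. -/
def localNormResidueSymbol (a : H₁ Torus) : DeckGroup (localCover h i r y) :=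
  (h.localReciprocity hr.torus_subset hy (𝒦.isPathConnected_torus i hr.1) (𝒦.isCompact_torus i r)
    (H₁.map (𝒦.torusToTorus i hr.1) a)).toMul

/-- The natural map `Gal(h_K) → Gal(h)`. -/
def localToGlobalGal : DeckGroup (localCover h i r y) →* h.Gal := h.extend hr.torus_subset hy

end Symbols
end KnotIdele

end

/-!
The product formula is functoriality of the reciprocity homomorphism `H₁(X) → G` of a covering
`Y → X` with abelian group `G`. Let a map of coverings `F` over `f : X → X'` be equivariant along
`φ : G → G'`. The monodromy of a `1`-simplex `σ` is measured in chosen points of the fibres, which `F`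
need not preserve; hence the monodromy of `f ∘ σ` is the image under `φ` of that of `σ` only up to the
coboundary of a `0`-cochain (`monodromyElement_map`). On homology the coboundary disappears, and
reciprocity commutes with `f` and `φ` (`reciprocity_map`).

For the inclusion of a component of `h⁻¹(∂V_K)` in `h⁻¹(M - L)`, with `φ` the extension of deck
transformations, this says that the image of `(α_K, h_K)` in `Gal(h)` is the value of the reciprocity
homomorphism of `h` at the image of `α_K` in `H₁(M - L)`
(`localToGlobalGal_localNormResidueSymbol`). Almost all of these images vanish, and their sum is the
component of the global reciprocity map in `H₁(M - L)`; applying reciprocity turns the sum into the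
product.

For a principal idele `α`, the global reciprocity map vanishes already in `lim H₁(M - F)`
(`TameLink.globalReciprocity_eq_zero`). If `F` contains all `K` with `v_K(α_K) ≠ 0` and is large
enough for the class in `H₂(M, 𝒦)` to live on `F`, then `(α_K)` with `K ⊂ F` is the boundary of a
class in `H₂(M - Int V, ∂V)`, so its image in `H₁(M - Int V)`, and hence in `H₁(M - F)`, is zero by
the exact sequence of the pair, while the other `α_K` bound in solid tori that miss `F`.
-/

open CategoryTheory CategoryTheory.Limits Simplicial Topology

namespace KnotIdele

/-! ### Naturality of the reciprocity homomorphism -/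

section Naturality

/-- If two `1`-cocycles correspond under a chain map up to the coboundary of a `0`-cochain `b`, then
they induce corresponding homomorphisms on first homology. -/
theorem homologyMap_comp_descOpcycles {C : Type*} [Category C] [Abelian C]
    {K L : ChainComplex C ℕ} (φ : K ⟶ L) {A A' : C} (m : K.X 1 ⟶ A) (hm : K.d 2 1 ≫ m = 0)
    (m' : L.X 1 ⟶ A') (hm' : L.d 2 1 ≫ m' = 0) (u : A ⟶ A') (b : K.X 0 ⟶ A')
    (h : φ.f 1 ≫ m' = m ≫ u + K.d 1 0 ≫ b) :
    HomologicalComplex.homologyMap φ 1 ≫ L.homologyι 1 ≫ L.descOpcycles m' 2 (by simp) hm' =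
      (K.homologyι 1 ≫ K.descOpcycles m 2 (by simp) hm) ≫ u := by
  have h1 : HomologicalComplex.opcyclesMap φ 1 ≫ L.descOpcycles m' 2 (by simp) hm' =
      K.descOpcycles m 2 (by simp) hm ≫ u + K.fromOpcycles 1 0 ≫ b := by
    rw [← cancel_epi (K.pOpcycles 1), HomologicalComplex.p_opcyclesMap_assoc,
      HomologicalComplex.p_descOpcycles, Preadditive.comp_add,
      HomologicalComplex.p_descOpcycles_assoc, HomologicalComplex.p_fromOpcycles_assoc, h]
  rw [HomologicalComplex.homologyι_naturality_assoc, h1, Preadditive.comp_add,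
    HomologicalComplex.homologyι_comp_fromOpcycles_assoc, zero_comp, add_zero, Category.assoc]

/-- The `0`-cochain with values in an abelian group `G`, written multiplicatively, that takes the
singular `0`-simplex at a point `x` to `c x`. -/
noncomputable def pointCochain {X : Type} [TopologicalSpace X] {G : Type} [CommGroup G]
    (c : X → G) :
    ((TopCat.toSSet.obj (TopCat.of X)).chainComplex (ModuleCat.of ℤ ℤ)).X 0 ⟶
      ModuleCat.of ℤ (Additive G) :=
  Sigma.desc fun σ : (TopCat.toSSet.obj (TopCat.of X)) _⦋0⦌ =>
    ModuleCat.ofHom (LinearMap.toSpanSingleton ℤ (Additive G)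
      (Additive.ofMul (c ((TopCat.toSSetObjEquiv _ _) σ (stdSimplex.vertex 0)))))

theorem ι_pointCochain {X : Type} [TopologicalSpace X] {G : Type} [CommGroup G] (c : X → G)
    (σ : (TopCat.toSSet.obj (TopCat.of X)) _⦋0⦌) :
    (TopCat.toSSet.obj (TopCat.of X)).ιChainComplex σ ≫ pointCochain c =
      ModuleCat.ofHom (LinearMap.toSpanSingleton ℤ (Additive G)
        (Additive.ofMul (c ((TopCat.toSSetObjEquiv _ _) σ (stdSimplex.vertex 0))))) :=
  Sigma.ι_desc _ _

variable {Y X Y' X' : Type} [TopologicalSpace Y] [TopologicalSpace X] [TopologicalSpace Y']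
  [TopologicalSpace X'] {p : Y → X} {p' : Y' → X'} {G G' : Type} [CommGroup G] [CommGroup G']
  [MulAction G Y] [MulAction G' Y'] (hp : IsQuotientCoveringMap p G)
  (hp' : IsQuotientCoveringMap p' G') {f : C(X, X')} {F : C(Y, Y')} {φ : G →* G'}

theorem fibreCoord_map (hφ : ∀ (g : G) (y : Y), F (g • y) = φ g • F y) (y : Y) :
    fibreCoord hp' (F y) =
      φ (fibreCoord hp y) * fibreCoord hp' (F (fibrePoint hp (p y))) := by
  rw [← fibreCoord_smul, ← hφ, fibreCoord_spec]

/-- The monodromy of the image of a `1`-simplex differs from the image of its monodromy by a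
coboundary, which measures how `F` fails to preserve the chosen points of the fibres. -/
theorem monodromyElement_map (hF : ∀ y, p' (F y) = f (p y))
    (hφ : ∀ (g : G) (y : Y), F (g • y) = φ g • F y) (σ : C(stdSimplex ℝ (Fin 2), X)) :
    monodromyElement hp' (f.comp σ) = φ (monodromyElement hp σ) *
      ((fibreCoord hp' (F (fibrePoint hp (σ (stdSimplex.vertex 1))))) *
        (fibreCoord hp' (F (fibrePoint hp (σ (stdSimplex.vertex 0)))))⁻¹) := by
  have hσ (t) : p (liftSimplex hp σ t) = σ t := congrFun (liftSimplex_spec hp σ) t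
  rw [monodromyElement_eq hp' (f.comp σ) (F.comp (liftSimplex hp σ))
    (funext fun t => (hF _).trans (congrArg f (hσ t))),
    ContinuousMap.comp_apply, ContinuousMap.comp_apply,
    fibreCoord_map hp hp' hφ (liftSimplex hp σ (stdSimplex.vertex 0)),
    fibreCoord_map hp hp' hφ (liftSimplex hp σ (stdSimplex.vertex 1)), hσ, hσ,
    monodromyElement, map_mul, map_inv, mul_inv]
  ac_rfl

/-- On `1`-chains, monodromy is natural up to the coboundary of `x ↦ fibreCoord (F (s x))`, with
`s x` the chosen point of the fibre over `x`. -/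
theorem chainsMap_monodromyCochain (hF : ∀ y, p' (F y) = f (p y))
    (hφ : ∀ (g : G) (y : Y), F (g • y) = φ g • F y) :
    (SSet.chainComplexMap (TopCat.toSSet.map (TopCat.ofHom f)) (ModuleCat.of ℤ ℤ)).f 1 ≫
        monodromyCochain hp' =
      monodromyCochain hp ≫ ModuleCat.ofHom φ.toAdditive.toIntLinearMap +
        ((TopCat.toSSet.obj (TopCat.of X)).chainComplex (ModuleCat.of ℤ ℤ)).d 1 0 ≫
          pointCochain fun x => fibreCoord hp' (F (fibrePoint hp x)) := by
  refine SSet.chainComplex_hom_ext fun σ => ?_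
  have h2 : TopCat.toSSetObjEquiv _ _ ((TopCat.toSSet.map (TopCat.ofHom f)).app _ σ) =
      f.comp (TopCat.toSSetObjEquiv _ _ σ) := rfl
  have hface (i : Fin 2) : TopCat.toSSetObjEquiv _ _
      ((TopCat.toSSet.obj (TopCat.of X)).δ i σ) = (TopCat.toSSetObjEquiv _ _ σ).comp
        ⟨stdSimplex.map (i.succAbove), stdSimplex.continuous_map _⟩ := rfl
  rw [Preadditive.comp_add, SSet.ι_chainComplexMap_f_assoc, ι_monodromyCochain, h2,
    monodromyElement_map hp hp' hF hφ, ← Category.assoc, ι_monodromyCochain,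
    SSet.ιChainComplex_d_assoc, Fin.sum_univ_two]
  simp only [Preadditive.add_comp, Preadditive.zsmul_comp, ι_pointCochain, hface,
    ContinuousMap.comp_apply, ContinuousMap.coe_mk, stdSimplex.map_vertex]
  ext
  simp [LinearMap.toSpanSingleton_apply, Fin.succAbove]

/-- The reciprocity homomorphism is natural: a map `F` of coverings over `f : X → X'`, equivariant
along `φ : G → G'`, intertwines the reciprocity homomorphisms. -/
theorem reciprocity_map (hF : ∀ y, p' (F y) = f (p y))
    (hφ : ∀ (g : G) (y : Y), F (g • y) = φ g • F y) (a : H₁ X) :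
    (reciprocity hp' (H₁.map f a)).toMul = φ (reciprocity hp a).toMul := by
  have key := homologyMap_comp_descOpcycles (chainsMap f) (monodromyCochain hp)
    (monodromyCochain_cocycle hp) (monodromyCochain hp') (monodromyCochain_cocycle hp')
    (ModuleCat.ofHom φ.toAdditive.toIntLinearMap) _ (chainsMap_monodromyCochain hp hp' hF hφ)
  exact congrArg Additive.toMul (congrArg (fun k => k.hom a) key)

end Naturality

/-! ### Local and global norm residue symbols -/

section LocalGlobal

variable {M : Type} [TopologicalSpace M] [T2Space M] {ι : Type} {𝒦 : TameLink M ι}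

/-- Local-global compatibility: the image in `Gal(h)` of a local norm residue symbol can be computed
in `M - L`. This is naturality of reciprocity for the inclusion of a component of `h⁻¹(∂V_i)` in the
unbranched part of the cover, which is equivariant along the extension of deck transformations. -/
theorem localToGlobalGal_localNormResidueSymbol {L : Finset ι}
    (h : AbelianBranchedCover M (𝒦.support L)) {i : ι} {r : ℝ} (hr : 𝒦.IsThin L i r) {y : h.N}
    (hy : h.map y ∈ 𝒦.torus i r) (a : H₁ Torus) :
    localToGlobalGal h hr hy (localNormResidueSymbol h hr hy a) =
      (reciprocity h.isQuotientCoveringMap_unbranched (𝒦.localToCompl L i a)).toMul := by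
  let := h.deckCommGroup hr.torus_subset hy
  have hmap : 𝒦.localToCompl L i a =
      H₁.map (incl hr.torus_subset) (H₁.map (𝒦.torusToTorus i hr.1) a) := by
    rw [𝒦.localToCompl_eq hr, ← H₁.map_comp]
    rfl
  rw [hmap]
  exact (reciprocity_map
    (h.isQuotientCoveringMap_restrict hr.torus_subset hy (𝒦.isPathConnected_torus i hr.1)
      (𝒦.isCompact_torus i r))
    h.isQuotientCoveringMap_unbranched
    (F := ⟨fun z => ⟨z.1, hr.torus_subset (h.component_subset z.2)⟩,
      continuous_subtype_val.subtype_mk _⟩)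
    (φ := h.extend hr.torus_subset hy) (fun _ => rfl)
    (fun g z => Subtype.ext (h.extend_apply hr.torus_subset hy g z).symm) _).symm

end LocalGlobal

/-! ### Principal ideles -/

/-- The composition `H₂(B, A) → H₁(A) → H₁(B)` vanishes. -/
theorem map_incl_relBoundary {M : Type} [TopologicalSpace M] {A B : Set M} (h : A ⊆ B)
    (c : relH₂ h) : H₁.map (incl h) (relBoundary h c) = 0 :=
  congrArg (fun k => k.hom c) ((pairSequence_shortExact h).δ_comp 2 1 rfl)

namespace TameLink

variable {M : Type} [TopologicalSpace M] {ι : Type} (𝒦 : TameLink M ι)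

theorem eventually_solid_subset (i : ι) {U : Set M} (hU : IsOpen U) (hi : 𝒦.core i ⊆ U) :
    ∀ᶠ r in 𝓝[>] (0 : ℝ), 𝒦.solid i r ⊆ U := by
  obtain ⟨A, V, -, hV, hA, h0, hAV⟩ := generalized_tube_lemma (s := (Set.univ : Set Circle))
    isCompact_univ (t := {(0 : ℂ)}) isCompact_singleton
    (hU.preimage (𝒦.isOpenEmbedding_tube i).continuous) (by
      rintro ⟨z, w⟩ ⟨-, rfl⟩
      exact hi ⟨z, rfl⟩)
  obtain ⟨s, hs, hsV⟩ := Metric.nhds_basis_closedBall.mem_iff.1 (hV.mem_nhds (h0 rfl))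
  filter_upwards [Ioc_mem_nhdsGT hs] with r hr
  rintro _ ⟨⟨z, w⟩, ⟨-, hw⟩, rfl⟩
  exact hAV ⟨hA trivial, hsV (Metric.closedBall_subset_closedBall hr.2 hw)⟩

/-- The components of a finite sublink have pairwise disjoint tubular neighbourhoods; a small common
radius will do. -/
theorem exists_isTubeSystem [T2Space M] (F : Finset ι) : ∃ r, 𝒦.IsTubeSystem F r := by
  have hdisj : ∀ i j, i ≠ j → ∀ᶠ r in 𝓝[>] (0 : ℝ), Disjoint (𝒦.solid i r) (𝒦.solid j r) := by
    intro i j hij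
    obtain ⟨U, V, hU, hV, hiU, hjV, hUV⟩ := SeparatedNhds.of_isCompact_isCompact
      (𝒦.isCompact_core i) (𝒦.isCompact_core j) (Set.disjoint_left.2 (by
        rintro _ ⟨z, rfl⟩ ⟨w, hw⟩
        exact 𝒦.disjoint_core i j hij z w hw.symm))
    filter_upwards [𝒦.eventually_solid_subset i hU hiU, 𝒦.eventually_solid_subset j hV hjV]
      with r h1 h2 using hUV.mono h1 h2
  have hall : ∀ᶠ r in 𝓝[>] (0 : ℝ), ∀ i ∈ F, ∀ j ∈ F, i ≠ j →
      Disjoint (𝒦.solid i r) (𝒦.solid j r) := by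
    simp only [Filter.eventually_all_finset, Filter.eventually_imp_distrib_left]
    exact fun i _ j _ => hdisj i j
  obtain ⟨r, hr, hpos⟩ := (hall.and self_mem_nhdsWithin).exists
  exact ⟨fun _ => r, fun _ _ => hpos, hr⟩

variable {𝒦} in
theorem IsTubeSystem.isThin {F : Finset ι} {r : ι → ℝ} (hr : 𝒦.IsTubeSystem F r) {i : ι}
    (hi : i ∈ F) : 𝒦.IsThin F i (r i) :=
  ⟨hr.1 i hi, fun j hj hji =>
    (hr.2 i hi j hj hji.symm).mono_right (𝒦.core_subset_solid j (hr.1 j hj))⟩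

variable {𝒦} in
theorem IsTubeSystem.exterior_subset {F : Finset ι} {r : ι → ℝ} (hr : 𝒦.IsTubeSystem F r) :
    𝒦.exterior F r ⊆ (𝒦.support F)ᶜ := by
  refine Set.compl_subset_compl.2 (Set.iUnion₂_mono fun i hi => ?_)
  rintro _ ⟨z, rfl⟩
  exact ⟨(z, 0), ⟨trivial, by simpa using hr.1 i hi⟩, rfl⟩

/-- Principal ideles lie in the kernel of the global reciprocity map. For a large finite sublink
`F`, the component in `H₁(M - F)` is the image of a boundary from `H₂(M - Int V, ∂V)`, hence is zero
already in `H₁(M - Int V)`; the components at smaller sublinks are images of this one. -/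
theorem globalReciprocity_eq_zero [T2Space M] {α : 𝒦.ideleGroup} (hα : α ∈ 𝒦.principalIdeles) :
    𝒦.globalReciprocity α = 0 := by
  classical
  obtain ⟨F₀, a, ha⟩ := hα
  refine Subtype.ext (funext fun L => ?_)
  -- `F` contains all `i` with `v_i (α_i) ≠ 0`, so only components at `F` contribute to `H₁(M - F)`.
  let F : Finset ι := F₀ ∪ L ∪ Set.Finite.toFinset α.2
  have hF₀ : F₀ ⊆ F := Finset.subset_union_left.trans Finset.subset_union_left
  have hL : L ⊆ F := Finset.subset_union_right.trans Finset.subset_union_left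
  rw [← (𝒦.globalReciprocity α).2 L F hL]
  suffices hsum : ∑ᶠ i, 𝒦.localToCompl F i (α.1 i) = 0 from
    (congrArg _ hsum).trans (map_zero _)
  obtain ⟨r, hr⟩ := 𝒦.exists_isTubeSystem F
  obtain ⟨c, -, hc⟩ := ha F hF₀ r hr
  rw [finsum_eq_sum_of_support_subset (s := F)]
  · have h0 : H₁.map (incl hr.exterior_subset) (H₁.map (incl hr.boundary_subset)
        (relBoundary hr.boundary_subset c)) = 0 := by rw [map_incl_relBoundary, map_zero]
    rw [hc, map_sum, map_sum] at h0
    rw [← Finset.sum_coe_sort, ← h0]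
    refine Finset.sum_congr rfl fun i _ => ?_
    rw [𝒦.localToCompl_eq (hr.isThin i.2), ← H₁.map_comp, ← H₁.map_comp]
    rfl
  · intro i hi
    by_contra hiF
    refine hi (𝒦.localToCompl_eq_zero hiF ?_)
    by_contra hv
    exact hiF (Finset.mem_union_right _ ((Set.Finite.mem_toFinset _).2 hv))

end TameLink
end KnotIdele

theorem mainTheorem2 {M : Type} [TopologicalSpace M] [T2Space M] [CompactSpace M]
    [ConnectedSpace M] [ChartedSpace (EuclideanSpace ℝ (Fin 3)) M]
    (hM : KnotIdele.HasRationalHomologyOfThreeSphere M)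
    {ι : Type} [Countable ι] [Infinite ι] (𝒦 : KnotIdele.TameLink M ι) (h𝒦 : 𝒦.IsAdmissible)
    (L : Finset ι) (h : KnotIdele.AbelianBranchedCover M (𝒦.support L))
    (r : ι → ℝ) (hr : ∀ i, 𝒦.IsThin L i (r i))
    (y : ι → h.N) (hy : ∀ i, h.map (y i) ∈ 𝒦.torus i (r i))
    (α : 𝒦.ideleGroup) :
    (Function.mulSupport fun i => KnotIdele.localToGlobalGal h (hr i) (hy i)
        (KnotIdele.localNormResidueSymbol h (hr i) (hy i) (α.1 i))).Finite ∧
      KnotIdele.normResidueSymbol h α =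
        ∏ᶠ i, KnotIdele.localToGlobalGal h (hr i) (hy i)
          (KnotIdele.localNormResidueSymbol h (hr i) (hy i) (α.1 i)) ∧
      (α ∈ 𝒦.principalIdeles → KnotIdele.normResidueSymbol h α = 1) := by
  have hfin := 𝒦.finite_localToCompl_ne_zero L α
  simp only [KnotIdele.localToGlobalGal_localNormResidueSymbol]
  have hsub : (Function.mulSupport fun i => (KnotIdele.reciprocity
      h.isQuotientCoveringMap_unbranched (𝒦.localToCompl L i (α.1 i))).toMul) ⊆
      Function.support fun i => 𝒦.localToCompl L i (α.1 i) := fun i hi hi0 => hi (by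
    dsimp only at hi0 ⊢
    rw [hi0, map_zero, toMul_zero])
  refine ⟨hfin.subset hsub, ?_, fun hα => ?_⟩
  · change (KnotIdele.reciprocity _ (∑ᶠ i, 𝒦.localToCompl L i (α.1 i))).toMul = _
    rw [finsum_eq_sum_of_support_subset (s := hfin.toFinset) _ (by simp),
      finprod_eq_prod_of_mulSupport_subset (s := hfin.toFinset) _ (by simpa using hsub),
      map_sum, toMul_sum]
  · rw [KnotIdele.normResidueSymbol, 𝒦.globalReciprocity_eq_zero hα]
    exact congrArg Additive.toMul
      (map_zero (KnotIdele.reciprocity h.isQuotientCoveringMap_unbranched))
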